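/- Identify subsets of $\omega$ with points of Cantor space ${}^\omega 2$ (called \emph{reals}), and let $\lambda$ be the uniform (fair coin) product measure on ${}^\omega 2$. For a finite binary string $\sigma$ let $[\sigma]$ be the set of all $X\in{}^\omega 2$ extending $\sigma$. An oracle $A\subseteq\omega$ is of \emph{hyperimmune degree} if there is a function $f:\omega\to\omega$, $f\le_T A$, such that for no computable function $g$ one has $f(n)\le g(n)$ for almost all $n$; otherwise $A$ is of \emph{hyperimmune-free degree}. An \emph{$A$-computable sequence of Kurtz tests relative to $A$} is a double sequence $(G^i_m)_{i,m\in\omega}$ of clopen subsets of ${}^\omega 2$ such that $\lambda(G^i_m)\le 2^{-m}$ for all $i,m$, and such that from $i$ and $m$ one can compute, with oracle $A$, a finite list of strings $\sigma_0,\dots,\sigma_{k-1}$ with $G^i_m=\bigcup_{j<k}[\sigma_j]$. The oracle $A$ is \emph{weakly Kurtz engulfing} if there is such a sequence for which $\bigcup_i\bigcap_m G^i_m$ contains all computable reals. Both properties depend only on the Turing degree of $A$, and there is a Turing degree that is hyperimmune-free and weakly Kurtz engulfing: that is, there is a Turing degree $\mathbf a$ of a set such that every $A\subseteq\omega$ of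 degree $\mathbf a$ is both of hyperimmune-free degree and weakly Kurtz engulfing. -/

import Mathlib

open MeasureTheory
open scoped ENNReal

/-- Cantor space, whose points ("reals") are identified with subsets of `ℕ`; they also serve as
oracles. -/
abbrev CantorSpace : Type := ℕ → Bool

/-- The characteristic function of `A` as an oracle. -/
def CantorSpace.oracle (A : CantorSpace) : ℕ →. ℕ := fun n => Part.some (A n).toNat

/-- The Turing degree of `A`. -/
def CantorSpace.degree (A : CantorSpace) : TuringDegree :=
  toAntisymmetrization TuringReducible A.oracle

/-- The uniform (fair coin) product measure on Cantor space. -/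
noncomputable def coinMeasure : Measure CantorSpace :=
  Measure.infinitePi fun _ : ℕ => (PMF.uniformOfFintype Bool).toMeasure

/-- The basic clopen set `[σ]` of all sequences extending the string `σ`. -/
def basicClopen (σ : List Bool) : Set CantorSpace :=
  {X | ∀ (n : ℕ) (h : n < σ.length), X n = σ[n]}

/-- The clopen set coded by a finite list of strings. -/
def clopenOf (D : List (List Bool)) : Set CantorSpace :=
  {X | ∃ σ ∈ D, X ∈ basicClopen σ}

/-- `(G i)` is an `A`-computable sequence of Kurtz tests relative to `A`: from `i` and `m`, the
oracle `A` computes a finite list of strings coding the clopen set `G i m`, and the measure of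
`G i m` is at most `2⁻ᵐ`. -/
structure IsKurtzTestSequence (A : CantorSpace) (G : ℕ → ℕ → Set CantorSpace) : Prop where
  effective : ∃ D : ℕ → ℕ → List (List Bool),
    ComputableIn₂ {A.oracle} D ∧ ∀ i m, G i m = clopenOf (D i m)
  measure_le : ∀ i m, coinMeasure (G i m) ≤ (2⁻¹ : ℝ≥0∞) ^ m

/-- Some `A`-computable sequence of Kurtz tests relative to `A` is such that the union of the
associated Kurtz null sets contains all computable reals. -/
def IsWeaklyKurtzEngulfing (A : CantorSpace) : Prop :=
  ∃ G : ℕ → ℕ → Set CantorSpace, IsKurtzTestSequence A G ∧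
    ∀ X : CantorSpace, Computable X → X ∈ ⋃ i, ⋂ m, G i m

/-- `A` is of hyperimmune degree: `A` computes a function that is not dominated by any computable
function. -/
def IsHyperimmuneOracle (A : CantorSpace) : Prop :=
  ∃ f : ℕ → ℕ, ComputableIn {A.oracle} f ∧
    ∀ g : ℕ → ℕ, Computable g → ¬ ∀ᶠ n in Filter.atTop, f n ≤ g n

/-- `A` is of hyperimmune-free degree. -/
def IsHyperimmuneFreeOracle (A : CantorSpace) : Prop := ¬ IsHyperimmuneOracle A

/-!
View an oracle as a sequence of binary rows, and list the `{0,1}`-valued partial computable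
functions as `ψ 0, ψ 1, …`. The oracles whose `i`-th row extends `ψ i` for all `i` form a nonempty
`Π⁰₁` class, and each computable real is a row of every member `A` of this class. Cutting the `i`-th
row of `A` at length `m` yields a single string, that is, a clopen set of measure `2⁻ᵐ`; for fixed
`i` these sets form a Kurtz test that captures the `i`-th row. Hence every member of the class is
weakly Kurtz engulfing.

By the hyperimmune-free basis theorem some member is of hyperimmune-free degree. Its proof is a
forcing argument with nonempty `Π⁰₁` classes `P`: either `Φ` diverges at a fixed argument on some
nonempty `Π⁰₁` subclass of `P`, or `Φ` is total on `P`, and then, by effective compactness, its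
values on `P` are bounded by a computable function.
-/

open Encodable Filter
open Nat.Partrec (Code)

section Computability

variable {α β σ : Type*} [Primcodable α] [Primcodable β] [Primcodable σ]

theorem exists_universal_partrec :
    ∃ ψ : ℕ → α →. σ, Partrec₂ ψ ∧ ∀ f : α →. σ, Partrec f → ∃ e, ψ e = f := by
  refine ⟨fun e a => ((Denumerable.ofNat Code e).eval (encode a)).bind fun v =>
    (decode v : Option σ), ?_, fun f hf => ?_⟩
  · have heval : Partrec₂ fun (e : ℕ) (a : α) => (Denumerable.ofNat Code e).eval (encode a) :=
      Code.eval_part.comp ((Computable.ofNat Code).comp .fst) (Computable.encode.comp .snd)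
    exact heval.bind (Computable.decode.comp .snd).ofOption.to₂
  · obtain ⟨c, hc⟩ := Code.exists_code.1 hf
    exact ⟨encode c, by ext; simp [hc]⟩

theorem rePred_or {p q : α → Prop} (hp : REPred p) (hq : REPred q) :
    REPred fun a => p a ∨ q a := by
  obtain ⟨k, hk, hdom⟩ := Partrec.merge' hp hq
  exact hk.dom_re.of_eq fun a => by simpa [Part.assert] using (hdom a).2

theorem rePred_mem_partrec {f : α →. σ} (hf : Partrec f) :
    REPred fun p : α × σ => p.2 ∈ f p.1 := by
  classical
  have hguard : Partrec₂ fun (p : α × σ) (v : σ) =>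
      ((if v = p.2 then some () else none : Option Unit) : Part Unit) :=
    (Primrec.ite (Primrec.eq.comp .snd (.comp .snd .fst)) (.const _) (.const _)).to_comp.ofOption
  exact ((hf.comp .fst).bind hguard).dom_re.of_eq fun p => by
    refine exists_congr fun hdom => ?_
    beta_reduce
    split_ifs with hv <;> simpa using hv

theorem primrecRel_exists_lt {R : ℕ → α → Prop} (hR : PrimrecRel R) :
    PrimrecRel fun n a => ∃ x < n, R x a :=
  (hR.exists_mem_list.comp (Primrec.list_range.comp .fst) .snd).of_eq (by simp)

variable {O : Set (ℕ →. ℕ)}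

theorem computableIn_comp {f : β → σ} {g : α → β} (hf : ComputableIn O f) (hg : ComputableIn O g) :
    ComputableIn O fun a => f (g a) :=
  (Nat.RecursiveIn.comp hf hg).of_eq fun n => by cases decode (α := α) n <;> simp

theorem computableIn_pair {f : α → β} {g : α → σ} (hf : ComputableIn O f) (hg : ComputableIn O g) :
    ComputableIn O fun a => (f a, g a) :=
  (Nat.RecursiveIn.pair hf hg).of_eq fun n => by cases decode (α := α) n <;> simp [Seq.seq]

theorem computableIn₂_natRec {f : α → σ} {h : α → ℕ × σ → σ} (hf : ComputableIn O f)
    (hh : ComputableIn₂ O h) :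
    ComputableIn₂ O fun (a : α) (n : ℕ) => (n.rec (f a) fun y s => h a (y, s) : σ) := by
  refine (Nat.RecursiveIn.prec hf hh).of_eq fun p => ?_
  simp only [decode_prod_val]
  cases ha : decode (α := α) p.unpair.1 with
  | none => induction p.unpair.2 <;> simp_all
  | some a => induction p.unpair.2 <;> simp_all

end Computability

section InitialSegment

/-- The string of the first `k` entries of the sequence `X`. It is the restriction of `X` to
`Fin k`, so that its continuity in `X` is that of a restriction map. -/
def initialSegment {α : Type*} (X : ℕ → α) (k : ℕ) : List α := List.ofFn fun i : Fin k => X i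

variable {α : Type*} (X : ℕ → α)

@[simp] theorem length_initialSegment (k : ℕ) : (initialSegment X k).length = k := by
  simp [initialSegment]

@[simp] theorem initialSegment_zero : initialSegment X 0 = [] := by
  simp [initialSegment]

theorem initialSegment_succ (k : ℕ) : initialSegment X (k + 1) = initialSegment X k ++ [X k] := by
  simp [initialSegment, List.ofFn_succ', -List.ofFn_succ]

theorem getElem?_initialSegment (j k : ℕ) :
    (initialSegment X k)[j]? = if j < k then some (X j) else none := by
  simp [initialSegment, List.getElem?_ofFn]

theorem take_initialSegment {j k : ℕ} (h : j ≤ k) :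
    (initialSegment X k).take j = initialSegment X j := by
  refine List.ext_getElem? fun i => ?_
  simp only [List.getElem?_take, getElem?_initialSegment]
  grind

theorem exists_initialSegment_length_eq [Nonempty α] (τ : List α) :
    ∃ X : ℕ → α, initialSegment X τ.length = τ :=
  ⟨fun i => τ.getD i (Classical.arbitrary α),
    List.ext_getElem (by simp) (by simp +contextual [initialSegment])⟩

theorem isClopen_setOf_initialSegment [TopologicalSpace α] [DiscreteTopology α]
    (p : List α → Prop) (k : ℕ) : IsClopen {X : ℕ → α | p (initialSegment X k)} :=
  (isClopen_discrete {Y : Fin k → α | p (List.ofFn Y)}).preimage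
    (f := fun (X : ℕ → α) (i : Fin k) => X i) (by fun_prop)

theorem computableIn₂_initialSegment {β : Type*} [Primcodable α] [Primcodable β]
    {O : Set (ℕ →. ℕ)} {g : β → ℕ → α} (hg : ComputableIn₂ O g) :
    ComputableIn₂ O fun b => initialSegment (g b) := by
  have hstep : ComputableIn₂ O fun (b : β) (p : ℕ × List α) => p.2 ++ [g b p.1] :=
    computableIn_comp Primrec.list_concat.computableIn₂ (computableIn_pair
      (Primrec.snd.comp .snd).computableIn
      (computableIn_comp hg (Primrec.pair .fst (.comp .fst .snd)).computableIn))
  refine (computableIn₂_natRec (ComputableIn.const []) hstep).of_eq fun p => ?_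
  obtain ⟨b, k⟩ := p
  refine congrArg Part.some ?_
  induction k with
  | zero => simp
  | succ k ih => exact (congrArg (· ++ [g b k]) ih).trans (initialSegment_succ _ k).symm

end InitialSegment

section EffectiveCompactness

variable {α : Type*} [Primcodable α]

/-- The list of all binary strings of length `L`. -/
def stringsOfLength : ℕ → List (List Bool)
  | 0 => [[]]
  | L + 1 => (stringsOfLength L).flatMap fun τ => [false :: τ, true :: τ]

theorem mem_stringsOfLength {L : ℕ} {τ : List Bool} : τ ∈ stringsOfLength L ↔ τ.length = L := by
  induction L generalizing τ with
  | zero => simp [stringsOfLength]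
  | succ L ih =>
    cases τ with
    | nil => simp [stringsOfLength]
    | cons b τ => cases b <;> simp [stringsOfLength, ih]

theorem primrec_stringsOfLength : Primrec stringsOfLength := by
  have hstep : Primrec₂ fun (_ : ℕ) (S : List (List Bool)) =>
      S.flatMap fun τ => [false :: τ, true :: τ] := by
    refine Primrec.list_flatMap .snd
      (Primrec.list_cons.comp ?_ (Primrec.list_cons.comp ?_ (.const [])))
    · exact Primrec.list_cons.comp (.const false) .snd
    · exact Primrec.list_cons.comp (.const true) .snd
  refine (Primrec.nat_rec₁ [[]] hstep).of_eq fun L => ?_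
  induction L with
  | zero => rfl
  | succ L ih => exact congrArg (List.flatMap _) ih

theorem forall_initialSegment_iff {p : List Bool → Prop} {L : ℕ} :
    (∀ X : CantorSpace, p (initialSegment X L)) ↔ ∀ τ ∈ stringsOfLength L, p τ := by
  simp only [mem_stringsOfLength]
  constructor
  · rintro h τ rfl
    obtain ⟨X, hX⟩ := exists_initialSegment_length_eq τ
    exact hX ▸ h X
  · exact fun h X => h _ (length_initialSegment X L)

theorem primrecRel_forall_initialSegment {R : List Bool → α → Prop} (hR : PrimrecRel R) :
    PrimrecRel fun (L : ℕ) (a : α) => ∀ X : CantorSpace, R (initialSegment X L) a :=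
  (hR.forall_mem_list.comp (primrec_stringsOfLength.comp .fst) .snd).of_eq
    fun _ => forall_initialSegment_iff.symm

theorem exists_primrec_approximation {σ : Type*} [Primcodable σ] {f : α →. σ} (hf : Partrec f) :
    ∃ F : ℕ → α → Option σ, Primrec₂ F ∧ (∀ {s t a v}, s ≤ t → v ∈ F s a → v ∈ F t a) ∧
      ∀ a v, v ∈ f a ↔ ∃ s, v ∈ F s a := by
  obtain ⟨c, hc⟩ := Code.exists_code.1 hf
  refine ⟨fun s a => (c.evaln s (encode a)).bind decode, ?_, ?_, fun a v => ?_⟩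
  · exact Primrec.option_bind (Code.primrec_evaln.comp (.pair (.pair .fst (.const c))
      (Primrec.encode.comp .snd))) (Primrec.decode.comp .snd).to₂
  · intro s t a v hst
    simp only [Option.mem_def, Option.bind_eq_some_iff]
    exact fun ⟨n, hn, hv⟩ => ⟨n, Code.evaln_mono hst hn, hv⟩
  · have heval (n : ℕ) : (∃ w ∈ f a, encode w = n) ↔ ∃ s, n ∈ c.evaln s (encode a) := by
      rw [← Code.evaln_complete, hc]
      simp
    simp only [Option.mem_def, Option.bind_eq_some_iff]
    rw [exists_comm]
    simp only [exists_and_right, ← Option.mem_def, ← heval]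
    simp [encodek]

theorem exists_forall_initialSegment {B : ℕ → List Bool → Prop}
    (hmono : ∀ {L M} {X : CantorSpace}, L ≤ M → B L (initialSegment X L) → B M (initialSegment X M))
    (hcover : ∀ X : CantorSpace, ∃ L, B L (initialSegment X L)) :
    ∃ L, ∀ X : CantorSpace, B L (initialSegment X L) := by
  let U (L : ℕ) : Set CantorSpace := {X | B L (initialSegment X L)}
  have hU : Monotone U := fun L M hLM X => hmono hLM
  obtain ⟨L, hL⟩ := isCompact_univ.elim_directed_cover U
    (fun L => (isClopen_setOf_initialSegment (B L) L).isOpen)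
    (fun X _ => Set.mem_iUnion.2 (hcover X)) hU.directed_le
  exact ⟨L, fun X => hL (Set.mem_univ X)⟩

theorem exists_computable_forall_initialSegment {B : α → ℕ → List Bool → Prop}
    (hB : PrimrecRel fun (τ : List Bool) (p : α × ℕ) => B p.1 p.2 τ)
    (hmono : ∀ {a L M} {X : CantorSpace}, L ≤ M →
      B a L (initialSegment X L) → B a M (initialSegment X M))
    (hcover : ∀ (a : α) (X : CantorSpace), ∃ L, B a L (initialSegment X L)) :
    ∃ g : α → ℕ, Computable g ∧
      ∀ (a : α) (X : CantorSpace), B a (g a) (initialSegment X (g a)) := by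
  classical
  have hsearch : PrimrecRel fun (a : α) (L : ℕ) => ∀ X : CantorSpace, B a L (initialSegment X L) :=
    (primrecRel_forall_initialSegment hB).comp .snd .id
  have hex (a : α) : ∃ L, ∀ X : CantorSpace, B a L (initialSegment X L) :=
    exists_forall_initialSegment hmono (hcover a)
  exact ⟨_, Computable.find hsearch.computablePred hex, fun a => Nat.find_spec (hex a)⟩

theorem primrecRel_exists_take_eq_some {σ : Type*} [Primcodable σ] {H : ℕ → α × List σ → Option ℕ}
    (hH : Primrec₂ H) :
    PrimrecRel fun (τ : List σ) (p : α × ℕ) =>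
      ∃ k < p.2, ∃ v < p.2, H p.2 (p.1, τ.take k) = some v := by
  have hbound : Primrec fun q : List σ × α × ℕ => q.2.2 := Primrec.snd.comp .snd
  have hvalue : PrimrecRel fun (v : ℕ) (q : ℕ × List σ × α × ℕ) =>
      H q.2.2.2 (q.2.2.1, q.2.1.take q.1) = some v := by
    refine Primrec.eq.comp (hH.comp ?_ (.pair ?_ (Primrec.list_take.comp ?_ ?_)))
      (Primrec.option_some.comp .fst)
    · exact hbound.comp (.comp .snd .snd)
    · exact Primrec.fst.comp (.comp .snd (.comp .snd .snd))
    · exact Primrec.fst.comp .snd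
    · exact Primrec.fst.comp (.comp .snd .snd)
  have hvalues := primrecRel_exists_lt hvalue
  have hsegment : PrimrecPred fun p : ℕ × List σ × α × ℕ =>
      ∃ v < p.2.2.2, H p.2.2.2 (p.2.2.1, p.2.1.take p.1) = some v :=
    hvalues.comp (hbound.comp .snd) .id
  have hsegments := primrecRel_exists_lt hsegment.primrecRel
  exact (hsegments.comp hbound .id).primrecRel

theorem exists_computable_bound_of_forall_dom {F : α → List Bool →. ℕ} (hF : Partrec₂ F)
    (hdom : ∀ (a : α) (X : CantorSpace), ∃ k, (F a (initialSegment X k)).Dom) :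
    ∃ g : α → ℕ, Computable g ∧
      ∀ (a : α) (X : CantorSpace), ∃ k, ∃ v ∈ F a (initialSegment X k), v ≤ g a := by
  obtain ⟨H, hH, hmono, hFH⟩ := exists_primrec_approximation hF
  -- `L` bounds the use, the value and the number of steps of a computation at the same time.
  let B (a : α) (L : ℕ) (τ : List Bool) : Prop := ∃ k < L, ∃ v < L, H L (a, τ.take k) = some v
  have hB : PrimrecRel fun (τ : List Bool) (p : α × ℕ) => B p.1 p.2 τ :=
    primrecRel_exists_take_eq_some hH
  have hB_iff {a L} {X : CantorSpace} : B a L (initialSegment X L) ↔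
      ∃ k < L, ∃ v < L, H L (a, initialSegment X k) = some v :=
    exists_congr fun k => and_congr_right fun hk => by rw [take_initialSegment X hk.le]
  have hB_mono {a L M} {X : CantorSpace} (hLM : L ≤ M) (h : B a L (initialSegment X L)) :
      B a M (initialSegment X M) := by
    obtain ⟨k, hk, v, hv, h⟩ := hB_iff.1 h
    exact hB_iff.2 ⟨k, hk.trans_le hLM, v, hv.trans_le hLM, hmono hLM h⟩
  have hB_cover (a : α) (X : CantorSpace) : ∃ L, B a L (initialSegment X L) := by
    obtain ⟨k, hk⟩ := hdom a X
    obtain ⟨v, hv⟩ := Part.dom_iff_mem.1 hk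
    obtain ⟨s, hs⟩ := (hFH (a, initialSegment X k) v).1 hv
    exact ⟨max s (max k v + 1), hB_iff.2 ⟨k, by grind, v, by grind, hmono (le_max_left _ _) hs⟩⟩
  obtain ⟨g, hg, hgB⟩ := exists_computable_forall_initialSegment hB hB_mono hB_cover
  refine ⟨g, hg, fun a X => ?_⟩
  obtain ⟨k, -, v, hv, h⟩ := hB_iff.1 (hgB a X)
  exact ⟨k, v, (hFH _ _).2 ⟨_, h⟩, hv.le⟩

end EffectiveCompactness

section Pi01Class

/-- A `Π⁰₁` class of Cantor space: the set of sequences that have no initial segment in some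
computably enumerable set of strings. -/
def IsPi01Class (P : Set CantorSpace) : Prop :=
  ∃ W : List Bool → Prop, REPred W ∧ P = {X | ∀ k, ¬W (initialSegment X k)}

theorem IsPi01Class.isClosed {P : Set CantorSpace} (hP : IsPi01Class P) : IsClosed P := by
  obtain ⟨W, -, rfl⟩ := hP
  simp only [Set.ofPred_forall]
  exact isClosed_iInter fun k => (isClopen_setOf_initialSegment (¬W ·) k).isClosed

theorem IsPi01Class.inter {P Q : Set CantorSpace} (hP : IsPi01Class P) (hQ : IsPi01Class Q) :
    IsPi01Class (P ∩ Q) := by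
  obtain ⟨V, hV, rfl⟩ := hP
  obtain ⟨W, hW, rfl⟩ := hQ
  exact ⟨_, rePred_or hV hW, by ext; simp [forall_and]⟩

theorem isPi01Class_setOf_extends {ψ : ℕ →. Bool} (hψ : Partrec ψ) :
    IsPi01Class {X | ∀ j, ∀ b ∈ ψ j, X j = b} := by
  have hlast : Computable fun τ : List Bool => τ[τ.length - 1]? :=
    (Primrec.list_getElem?.comp .id (Primrec.nat_sub.comp .list_length (.const 1))).to_comp
  have hflip : Partrec fun τ : List Bool => (ψ (τ.length - 1)).map fun b => some !b :=
    (hψ.comp (Primrec.nat_sub.comp .list_length (.const 1)).to_comp).map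
      (Primrec.option_some.comp (Primrec.not.comp .snd)).to_comp.to₂
  -- The bit at position `j` is tested on the initial segment of length `j + 1` only.
  refine ⟨_, (rePred_mem_partrec hflip).comp (Computable.id.pair hlast), ?_⟩
  ext X
  constructor
  · rintro hX (_ | j) h
    · simp at h
    · obtain ⟨b, hb, hXb⟩ : ∃ b ∈ ψ j, (!b) = X j := by
        simpa [initialSegment_succ] using h
      simp [← hX j b hb] at hXb
  · intro hX j b hb
    by_contra hne
    refine hX (j + 1) ?_
    simpa [initialSegment_succ, Bool.eq_not.2 hne] using hb

theorem isPi01Class_setOf_forall_not_dom {Φ : List Bool →. ℕ} (hΦ : Partrec Φ) :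
    IsPi01Class {X | ∀ k, ¬(Φ (initialSegment X k)).Dom} :=
  ⟨_, hΦ.dom_re, rfl⟩

theorem IsPi01Class.exists_computable_bound {P : Set CantorSpace} (hP : IsPi01Class P)
    {Φ : List Bool → ℕ →. ℕ} (hΦ : Partrec₂ Φ)
    (htotal : ∀ n, ∀ X ∈ P, ∃ k, (Φ (initialSegment X k) n).Dom) :
    ∃ g : ℕ → ℕ, Computable g ∧
      ∀ X ∈ P, ∀ n, ∃ k, ∃ v ∈ Φ (initialSegment X k) n, v ≤ g n := by
  obtain ⟨W, hW, rfl⟩ := hP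
  have hΦ' : Partrec fun p : ℕ × List Bool => Φ p.2 p.1 := hΦ.comp .snd .fst
  have hW' : Partrec fun p : ℕ × List Bool =>
      (Part.assert (W p.2) fun _ => .some ()).map fun _ => 0 :=
    (hW.comp .snd).map (Computable.const 0).to₂
  obtain ⟨F, hF, hFspec⟩ := Partrec.merge' hΦ' hW'
  have hFmem {n X k v} (hX : ∀ k, ¬W (initialSegment X k)) (hv : v ∈ F (n, initialSegment X k)) :
      v ∈ Φ (initialSegment X k) n :=
    ((hFspec _).1 v hv).resolve_right (by simp [hX k])
  have hFdom (n : ℕ) (X : CantorSpace) : ∃ k, (F (n, initialSegment X k)).Dom := by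
    simp only [(hFspec _).2]
    by_cases hX : ∀ k, ¬W (initialSegment X k)
    · exact (htotal n X hX).imp fun k => .inl
    · obtain ⟨k, hk⟩ := not_forall_not.1 hX
      exact ⟨k, .inr ⟨hk, trivial⟩⟩
  obtain ⟨g, hg, hbound⟩ :=
    exists_computable_bound_of_forall_dom (F := fun n τ => F (n, τ)) hF hFdom
  refine ⟨g, hg, fun X hX n => ?_⟩
  obtain ⟨k, v, hv, hle⟩ := hbound n X
  exact ⟨k, v, hFmem hX hv, hle⟩

end Pi01Class

section UsePrinciple

/-- The partial recursive functional `Φ`, which sees only a finite string of oracle bits, computes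
`f` from the oracle `A`. Its values on initial segments of `A` are correct, and every value of `f`
is found on all sufficiently long ones; on strings that are not initial segments of `A` it may take
arbitrary values. -/
structure ComputesFrom (Φ : List Bool → ℕ →. ℕ) (A : CantorSpace) (f : ℕ →. ℕ) : Prop where
  partrec : Partrec₂ Φ
  sound {k n v : ℕ} : v ∈ Φ (initialSegment A k) n → v ∈ f n
  eventually_mem {n v : ℕ} : v ∈ f n → ∀ᶠ k in atTop, v ∈ Φ (initialSegment A k) n

namespace ComputesFrom

variable {A : CantorSpace} {f h : ℕ →. ℕ} {Φ Ψ : List Bool → ℕ →. ℕ}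

theorem of_partrec (hf : Partrec f) : ComputesFrom (fun _ => f) A f where
  partrec := hf.comp .snd
  sound := id
  eventually_mem hv := .of_forall fun _ => hv

theorem oracle (A : CantorSpace) :
    ComputesFrom (fun τ n => (τ[n]?.map Bool.toNat : Option ℕ)) A A.oracle where
  partrec := (Primrec.option_map Primrec.list_getElem?
    ((Primrec.dom_bool Bool.toNat).comp .snd).to₂).to_comp.ofOption
  sound hv := by
    rw [getElem?_initialSegment] at hv
    split_ifs at hv <;> simp_all [CantorSpace.oracle]
  eventually_mem {n v} hv := by
    filter_upwards [eventually_gt_atTop n] with k hk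
    rw [getElem?_initialSegment, if_pos hk]
    simpa [CantorSpace.oracle] using hv

theorem pair (hf : ComputesFrom Φ A f) (hh : ComputesFrom Ψ A h) :
    ComputesFrom (fun τ n => Nat.pair <$> Φ τ n <*> Ψ τ n) A
      fun n => Nat.pair <$> f n <*> h n where
  partrec := by
    have hpair : Partrec fun p : List Bool × ℕ =>
        (Φ p.1 p.2).bind fun v => (Ψ p.1 p.2).map fun w => Nat.pair v w :=
      hf.partrec.bind ((hh.partrec.comp (.comp .fst .fst) (.comp .snd .fst)).map
        (Primrec₂.natPair.comp (.comp .snd .fst) .snd).to_comp.to₂).to₂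
    exact hpair.of_eq fun p => by simp [Seq.seq, Part.bind_map]
  sound {k n v} := by
    simp only [Seq.seq, Part.map_eq_map, Part.bind_map, Part.mem_bind_iff, Part.mem_map_iff]
    exact fun ⟨i, hi, j, hj, hv⟩ => ⟨i, hf.sound hi, j, hh.sound hj, hv⟩
  eventually_mem {n v} := by
    simp only [Seq.seq, Part.map_eq_map, Part.bind_map, Part.mem_bind_iff, Part.mem_map_iff]
    rintro ⟨i, hi, j, hj, hv⟩
    filter_upwards [hf.eventually_mem hi, hh.eventually_mem hj] with k hki hkj
    exact ⟨i, hki, j, hkj, hv⟩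

theorem comp (hf : ComputesFrom Φ A f) (hh : ComputesFrom Ψ A h) :
    ComputesFrom (fun τ n => (Ψ τ n).bind (Φ τ)) A fun n => (h n).bind f where
  partrec := hh.partrec.bind (hf.partrec.comp (.comp .fst .fst) .snd).to₂
  sound hv := by
    obtain ⟨w, hw, hv⟩ := Part.mem_bind_iff.1 hv
    exact Part.mem_bind (hh.sound hw) (hf.sound hv)
  eventually_mem hv := by
    obtain ⟨w, hw, hv⟩ := Part.mem_bind_iff.1 hv
    filter_upwards [hh.eventually_mem hw, hf.eventually_mem hv] with k hkw hkv
    exact Part.mem_bind hkw hkv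

theorem prec (hf : ComputesFrom Φ A f) (hh : ComputesFrom Ψ A h) :
    ComputesFrom
      (fun τ p => p.unpair.2.rec (Φ τ p.unpair.1) fun y s =>
        s.bind fun i => Ψ τ (Nat.pair p.unpair.1 (Nat.pair y i))) A
      (fun p => p.unpair.2.rec (f p.unpair.1) fun y s =>
        s.bind fun i => h (Nat.pair p.unpair.1 (Nat.pair y i))) where
  partrec := by
    have harg : Primrec fun q : List Bool × ℕ => q.2.unpair.1 :=
      Primrec.fst.comp (Primrec.unpair.comp .snd)
    have hstep : Partrec₂ fun (q : List Bool × ℕ) (r : ℕ × ℕ) =>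
        Ψ q.1 (Nat.pair q.2.unpair.1 (Nat.pair r.1 r.2)) :=
      hh.partrec.comp (.comp .fst .fst) (Primrec₂.natPair.comp (harg.comp .fst)
        (Primrec₂.natPair.comp (.comp .fst .snd) (.comp .snd .snd))).to_comp
    exact Partrec.nat_rec (Primrec.snd.comp (Primrec.unpair.comp .snd)).to_comp
      (hf.partrec.comp .fst harg.to_comp) hstep
  sound {k p v} := by
    induction p.unpair.2 generalizing v with
    | zero => exact hf.sound
    | succ y ih =>
      intro hv
      obtain ⟨i, hi, hv⟩ := Part.mem_bind_iff.1 hv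
      exact Part.mem_bind (ih hi) (hh.sound hv)
  eventually_mem {p v} := by
    induction p.unpair.2 generalizing v with
    | zero => exact hf.eventually_mem
    | succ y ih =>
      intro hv
      obtain ⟨i, hi, hv⟩ := Part.mem_bind_iff.1 hv
      filter_upwards [ih hi, hh.eventually_mem hv] with k hki hkv
      exact Part.mem_bind hki hkv

theorem rfind (hf : ComputesFrom Φ A f) :
    ComputesFrom (fun τ a => Nat.rfind fun n => (Φ τ (Nat.pair a n)).map (· = 0)) A
      fun a => Nat.rfind fun n => (f (Nat.pair a n)).map (· = 0) where
  partrec := Partrec.rfind ((hf.partrec.comp (.comp .fst .fst)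
      (Primrec₂.natPair.comp (.comp .snd .fst) .snd).to_comp).map
    (Primrec.eq.decide.comp .snd (.const 0)).to_comp.to₂).to₂
  sound hx := by
    obtain ⟨htrue, hfalse⟩ := Nat.mem_rfind.1 hx
    refine Nat.mem_rfind.2 ⟨?_, fun hm => ?_⟩
    · exact (Part.mem_map_iff _).2 (((Part.mem_map_iff _).1 htrue).imp fun _ => .imp_left hf.sound)
    · exact (Part.mem_map_iff _).2
        (((Part.mem_map_iff _).1 (hfalse hm)).imp fun _ => .imp_left hf.sound)
  eventually_mem {a x} hx := by
    have hmap {n : ℕ} {b : Bool} (hb : b ∈ (f (Nat.pair a n)).map fun v => decide (v = 0)) :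
        ∀ᶠ k in atTop, b ∈ (Φ (initialSegment A k) (Nat.pair a n)).map fun v => decide (v = 0) := by
      obtain ⟨v, hv, hvb⟩ := (Part.mem_map_iff _).1 hb
      exact (hf.eventually_mem hv).mono fun k hk => (Part.mem_map_iff _).2 ⟨v, hk, hvb⟩
    obtain ⟨htrue, hfalse⟩ := Nat.mem_rfind.1 hx
    filter_upwards [hmap htrue, (eventually_all_finite (Set.finite_Iio x)).2 fun m hm =>
      hmap (hfalse hm)] with k hktrue hkfalse
    exact Nat.mem_rfind.2 ⟨hktrue, fun hm => hkfalse _ hm⟩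

end ComputesFrom

theorem exists_computesFrom {A : CantorSpace} {f : ℕ →. ℕ} (hf : Nat.RecursiveIn {A.oracle} f) :
    ∃ Φ, ComputesFrom Φ A f := by
  induction hf with
  | zero => exact ⟨_, .of_partrec (Partrec.nat_iff.2 .zero)⟩
  | succ => exact ⟨_, .of_partrec (Partrec.nat_iff.2 .succ)⟩
  | left => exact ⟨_, .of_partrec (Partrec.nat_iff.2 .left)⟩
  | right => exact ⟨_, .of_partrec (Partrec.nat_iff.2 .right)⟩
  | oracle g hg => exact ⟨_, by rw [Set.mem_singleton_iff.1 hg]; exact .oracle A⟩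
  | pair _ _ ihf ihh => exact ihf.elim fun _ hf => ihh.elim fun _ hh => ⟨_, hf.pair hh⟩
  | comp _ _ ihf ihh => exact ihf.elim fun _ hf => ihh.elim fun _ hh => ⟨_, hf.comp hh⟩
  | prec _ _ ihf ihh => exact ihf.elim fun _ hf => ihh.elim fun _ hh => ⟨_, hf.prec hh⟩
  | rfind _ ihf => exact ihf.elim fun _ hf => ⟨_, hf.rfind⟩

end UsePrinciple

section HyperimmuneFreeBasis

/-- If the functional `Φ` yields a total function on the oracle `X`, then that function is majorized
by a computable one. Values found on different initial segments of `X` need not agree, so only one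
value per argument is required to satisfy the bound. -/
def TotalImpliesMajorized (Φ : List Bool → ℕ →. ℕ) (X : CantorSpace) : Prop :=
  (∀ n, ∃ k, (Φ (initialSegment X k) n).Dom) →
    ∃ g : ℕ → ℕ, Computable g ∧ ∀ n, ∃ k, ∃ v ∈ Φ (initialSegment X k) n, v ≤ g n

theorem isHyperimmuneFreeOracle_of_forall_totalImpliesMajorized {A : CantorSpace}
    (hA : ∀ Φ, Partrec₂ Φ → TotalImpliesMajorized Φ A) : IsHyperimmuneFreeOracle A := by
  rintro ⟨f, hf, hescape⟩
  obtain ⟨Φ, hΦ⟩ := exists_computesFrom (RecursiveIn.iff_nat.1 hf)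
  obtain ⟨g, hg, hbound⟩ := hA Φ hΦ.partrec fun n =>
    (hΦ.eventually_mem (Part.mem_some (f n))).exists.imp fun k hk => Part.dom_iff_mem.2 ⟨_, hk⟩
  refine hescape g hg (.of_forall fun n => ?_)
  obtain ⟨k, v, hv, hle⟩ := hbound n
  exact (Part.mem_some_iff.1 (hΦ.sound hv)).ge.trans hle

theorem IsPi01Class.exists_subset_totalImpliesMajorized {Φ : List Bool → ℕ →. ℕ}
    (hΦ : Partrec₂ Φ) {P : Set CantorSpace} (hP : IsPi01Class P) (hne : P.Nonempty) :
    ∃ Q ⊆ P, IsPi01Class Q ∧ Q.Nonempty ∧ ∀ X ∈ Q, TotalImpliesMajorized Φ X := by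
  let D (n : ℕ) : Set CantorSpace := {X | ∀ k, ¬(Φ (initialSegment X k) n).Dom}
  by_cases h : ∃ n, (P ∩ D n).Nonempty
  · obtain ⟨n, hn⟩ := h
    have hD : IsPi01Class (D n) := isPi01Class_setOf_forall_not_dom (hΦ.comp .id (.const n))
    refine ⟨P ∩ D n, Set.inter_subset_left, hP.inter hD, hn, fun X hX htotal => ?_⟩
    obtain ⟨k, hk⟩ := htotal n
    exact absurd hk (hX.2 k)
  · have htotal (n : ℕ) (X : CantorSpace) (hX : X ∈ P) : ∃ k, (Φ (initialSegment X k) n).Dom :=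
      not_forall_not.1 fun hXn => h ⟨n, X, hX, hXn⟩
    obtain ⟨g, hg, hbound⟩ := hP.exists_computable_bound hΦ htotal
    exact ⟨P, subset_rfl, hP, hne, fun X hX _ => ⟨g, hg, hbound X hX⟩⟩

theorem exists_mem_forall_of_forall_exists_subset {α : Type*} [TopologicalSpace α] [CompactSpace α]
    {C : Set α → Prop} (hclosed : ∀ P, C P → IsClosed P) {R : ℕ → α → Prop}
    (hdense : ∀ n P, C P → P.Nonempty → ∃ Q ⊆ P, C Q ∧ Q.Nonempty ∧ ∀ x ∈ Q, R n x)
    {P : Set α} (hP : C P) (hne : P.Nonempty) : ∃ x ∈ P, ∀ n, R n x := by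
  choose! next hsub hC hnext hR using hdense
  let t (n : ℕ) : Set α := n.rec P next
  have ht (n : ℕ) : C (t n) ∧ (t n).Nonempty := by
    induction n with
    | zero => exact ⟨hP, hne⟩
    | succ n ih => exact ⟨hC n _ ih.1 ih.2, hnext n _ ih.1 ih.2⟩
  obtain ⟨x, hx⟩ := IsCompact.nonempty_iInter_of_sequence_nonempty_isCompact_isClosed t
    (fun n => hsub n _ (ht n).1 (ht n).2) (fun n => (ht n).2) (hclosed P hP).isCompact
    fun n => hclosed _ (ht n).1
  rw [Set.mem_iInter] at hx
  exact ⟨x, hx 0, fun n => hR n _ (ht n).1 (ht n).2 x (hx (n + 1))⟩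

theorem IsPi01Class.exists_mem_isHyperimmuneFreeOracle {P : Set CantorSpace} (hP : IsPi01Class P)
    (hne : P.Nonempty) : ∃ A ∈ P, IsHyperimmuneFreeOracle A := by
  obtain ⟨Θ, hΘ, huniversal⟩ := exists_universal_partrec (α := List Bool × ℕ) (σ := ℕ)
  have hΘ' (e : ℕ) : Partrec₂ fun τ n => Θ e (τ, n) := hΘ.comp (.const e) .id
  obtain ⟨A, hAP, hA⟩ := exists_mem_forall_of_forall_exists_subset (fun _ => IsPi01Class.isClosed)
    (fun e _ => IsPi01Class.exists_subset_totalImpliesMajorized (hΘ' e)) hP hne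
  refine ⟨A, hAP, isHyperimmuneFreeOracle_of_forall_totalImpliesMajorized fun Φ hΦ => ?_⟩
  obtain ⟨e, he⟩ := huniversal (fun p => Φ p.1 p.2) hΦ
  simpa [he] using hA e

end HyperimmuneFreeBasis

section WeaklyKurtzEngulfing

theorem exists_isPi01Class_forall_computable_row :
    ∃ P : Set CantorSpace, IsPi01Class P ∧ P.Nonempty ∧ ∀ A ∈ P, ∀ X : CantorSpace, Computable X →
      ∃ i, ∀ n, A (Nat.pair i n) = X n := by
  classical
  obtain ⟨ψ, hψ, huniversal⟩ := exists_universal_partrec (α := ℕ) (σ := Bool)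
  let φ (j : ℕ) : Part Bool := ψ j.unpair.1 j.unpair.2
  have hφ : Partrec φ :=
    hψ.comp (Primrec.fst.comp .unpair).to_comp (Primrec.snd.comp .unpair).to_comp
  refine ⟨{A | ∀ j, ∀ b ∈ φ j, A j = b}, isPi01Class_setOf_extends hφ, ?_, fun A hA X hX => ?_⟩
  · refine ⟨fun j => (φ j).getOrElse false, fun j b hb => ?_⟩
    exact (Part.getOrElse_of_dom _ hb.fst false).trans (Part.get_eq_of_mem hb hb.fst)
  · obtain ⟨i, hi⟩ := huniversal X hX
    exact ⟨i, fun n => hA _ _ (by simp [φ, hi])⟩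

theorem coinMeasure_basicClopen (σ : List Bool) :
    coinMeasure (basicClopen σ) = (2⁻¹ : ℝ≥0∞) ^ σ.length := by
  have h : basicClopen σ =
      Set.pi (Finset.range σ.length : Set ℕ) fun n => {σ.getD n false} := by
    ext X
    simp only [basicClopen, Set.mem_ofPred_eq, Set.mem_pi, Finset.coe_range, Set.mem_Iio,
      Set.mem_singleton_iff]
    exact forall₂_congr fun n hn => by simp [hn]
  rw [h, coinMeasure, Measure.infinitePi_pi _ fun _ _ => MeasurableSet.of_discrete]
  simp

theorem clopenOf_singleton (σ : List Bool) : clopenOf [σ] = basicClopen σ := by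
  ext X
  simp [clopenOf]

theorem mem_basicClopen_initialSegment (X : CantorSpace) (k : ℕ) :
    X ∈ basicClopen (initialSegment X k) := fun n hn => by
  simp [initialSegment]

theorem computableIn_oracle (A : CantorSpace) : ComputableIn {A.oracle} A :=
  (Nat.RecursiveIn.oracle A.oracle (Set.mem_singleton _)).of_eq fun n => by
    cases h : A n <;> simp [CantorSpace.oracle, h]

theorem isWeaklyKurtzEngulfing_of_forall_computable_row {A : CantorSpace}
    (hA : ∀ X : CantorSpace, Computable X → ∃ i, ∀ n, A (Nat.pair i n) = X n) :
    IsWeaklyKurtzEngulfing A := by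
  let row (i : ℕ) : CantorSpace := fun n => A (Nat.pair i n)
  have hrow : ComputableIn₂ {A.oracle} row :=
    computableIn_comp (computableIn_oracle A) Primrec₂.natPair.computableIn
  have hsegment : ComputableIn₂ {A.oracle} fun i m => [initialSegment (row i) m] :=
    computableIn_comp (Primrec.list_cons.comp .id (.const [])).computableIn
      (computableIn₂_initialSegment hrow)
  refine ⟨fun i m => clopenOf [initialSegment (row i) m], ⟨⟨_, hsegment, fun _ _ => rfl⟩, ?_⟩, ?_⟩
  · simp [clopenOf_singleton, coinMeasure_basicClopen]
  · intro X hX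
    obtain ⟨i, hi⟩ := hA X hX
    obtain rfl : row i = X := funext hi
    refine Set.mem_iUnion.2 ⟨i, Set.mem_iInter.2 fun m => ?_⟩
    exact ⟨_, List.mem_singleton_self _, mem_basicClopen_initialSegment _ m⟩

end WeaklyKurtzEngulfing

theorem turingReducible_of_degree_eq {A B : CantorSpace} (h : A.degree = B.degree) :
    TuringReducible A.oracle B.oracle :=
  (Quotient.exact h).1

theorem IsHyperimmuneFreeOracle.of_turingReducible {A B : CantorSpace}
    (hB : IsHyperimmuneFreeOracle B) (h : TuringReducible A.oracle B.oracle) :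
    IsHyperimmuneFreeOracle A := by
  rintro ⟨f, hf, hdom⟩
  exact hB ⟨f, RecursiveIn.subst hf (by simpa using h), hdom⟩

theorem IsWeaklyKurtzEngulfing.of_turingReducible {A B : CantorSpace}
    (hA : IsWeaklyKurtzEngulfing A) (h : TuringReducible A.oracle B.oracle) :
    IsWeaklyKurtzEngulfing B := by
  obtain ⟨G, ⟨⟨D, hD, hG⟩, hle⟩, hcov⟩ := hA
  exact ⟨G, ⟨⟨D, RecursiveIn.subst hD (by simpa using h), hG⟩, hle⟩, hcov⟩

theorem mainTheorem7 :
    ∃ a : TuringDegree, (∃ A : CantorSpace, A.degree = a) ∧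
      ∀ A : CantorSpace, A.degree = a →
        IsHyperimmuneFreeOracle A ∧ IsWeaklyKurtzEngulfing A := by
  obtain ⟨P, hP, hne, hrow⟩ := exists_isPi01Class_forall_computable_row
  obtain ⟨A, hAP, hfree⟩ := hP.exists_mem_isHyperimmuneFreeOracle hne
  have hengulf : IsWeaklyKurtzEngulfing A :=
    isWeaklyKurtzEngulfing_of_forall_computable_row (hrow A hAP)
  exact ⟨A.degree, ⟨A, rfl⟩, fun B hB =>
    ⟨hfree.of_turingReducible (turingReducible_of_degree_eq hB),
      hengulf.of_turingReducible (turingReducible_of_degree_eq hB.symm)⟩⟩
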